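/- Let $X_1,X_2,\dots$ be i.i.d. real-valued random variables on a probability space, $S_n=X_1+\dots+X_n$, and let $p,q>0$ with $p+q=1$. Assume that, as $x\to\infty$, $$\mathbb P(X_1>x)=\frac px+O\Big(\frac1{x^2}\Big),\qquad \mathbb P(X_1<-x)=\frac qx+O\Big(\frac1{x^2}\Big).$$ Assume moreover that the characteristic function $\Psi(t)=\mathbb E(e^{itX_1})$ is twice differentiable at all sufficiently small $t>0$ and that there are $c,C_0,C\in\mathbb R$ and $C'\in\mathbb C$ such that, as $t\to0^+$, $$\Psi(t)=1-ci|t|\log|t|+C_0it+C|t|+O\big(t^2|\log|t||\big),$$ $$\Psi'(t)=-ci\log|t|+C'+O\big(|t\log|t||\big),\qquad \Psi''(t)=-cit^{-1}+O\big(|\log|t||\big)$$ (the behaviour as $t\to0^-$ is then given by $\Psi(-t)=\overline{\Psi(t)}$). Let $(a_n)$ be a real sequence with $a_n=n(1+o(1))$ and put $b_n=n\,\mathbb E\big(X_1\mathbf 1_{\{|X_1|\le a_n\}}\big)$. Fix a finite number $a>2$. Let $x(n)$ be a real sequence and put $N=N(n)=x(n)+b_n$; assume that $N\to\infty$ and $n(\log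 N)^2=o(N)$ as $n\to\infty$. Then, as $n\to\infty$, $$\mathbb P(S_n>N)=n\,\mathbb P(X_1>N)+O\Big(\frac{n^2(\log N)^2}{N^2}\Big)+O\Big(\frac n{N^{2-2/a}}\Big)$$ and $$\mathbb P(S_n<-N)=n\,\mathbb P(X_1<-N)+O\Big(\frac{n^2(\log N)^2}{N^2}\Big)+O\Big(\frac n{N^{2-2/a}}\Big).$$ -/

import Mathlib

open MeasureTheory ProbabilityTheory Filter Topology Asymptotics

noncomputable section

/-- The partial sum of the first `n` variables; the first variable is `X 0`. -/
def partialSum {Ω : Type*} (X : ℕ → Ω → ℝ) (n : ℕ) (ω : Ω) : ℝ :=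
  ∑ i ∈ Finset.range n, X i ω

/-- The centring constant `n * E[X ; |X| ≤ a n]` for the scaling sequence `a`. -/
def centring {Ω : Type*} [MeasurableSpace Ω] (μ : Measure Ω) (X : Ω → ℝ) (a : ℕ → ℝ)
    (n : ℕ) : ℝ :=
  n * ∫ ω, Set.indicator {ω' | |X ω'| ≤ a n} X ω ∂μ

/-- `P(X > x) = p / x + O(1 / x ^ 2)` and `P(X < -x) = q / x + O(1 / x ^ 2)` as `x → ∞`. -/
structure HasTailExpansion {Ω : Type*} [MeasurableSpace Ω] (μ : Measure Ω) (X : Ω → ℝ)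
    (p q : ℝ) : Prop where
  right : (fun x : ℝ => μ.real {ω | x < X ω} - p / x) =O[atTop] fun x : ℝ => 1 / x ^ 2
  left : (fun x : ℝ => μ.real {ω | X ω < -x} - q / x) =O[atTop] fun x : ℝ => 1 / x ^ 2

/-- Expansion as `t → 0+` of a characteristic function and of its first two derivatives, which
are required to exist at all small `t > 0`. The behaviour as `t → 0-` is then determined by
`Ψ (-t) = conj (Ψ t)`. -/
structure HasCharFunExpansion (Ψ : ℝ → ℂ) (c C₀ C : ℝ) (C' : ℂ) : Prop where
  differentiable : ∀ᶠ t in 𝓝[>] (0 : ℝ), DifferentiableAt ℝ Ψ t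
  differentiable_deriv : ∀ᶠ t in 𝓝[>] (0 : ℝ), DifferentiableAt ℝ (deriv Ψ) t
  expansion :
    (fun t : ℝ => Ψ t - (1 - c * Complex.I * |t| * Real.log |t| + C₀ * Complex.I * t + C * |t|))
      =O[𝓝[>] 0] fun t : ℝ => t ^ 2 * |Real.log (|t|)|
  expansion_deriv :
    (fun t : ℝ => deriv Ψ t - (-c * Complex.I * Real.log |t| + C'))
      =O[𝓝[>] 0] fun t : ℝ => |t * Real.log (|t|)|
  expansion_deriv_two :
    (fun t : ℝ => deriv (deriv Ψ) t - (-c * Complex.I * (t : ℂ)⁻¹))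
      =O[𝓝[>] 0] fun t : ℝ => |Real.log (|t|)|

end

/-!
The estimate is the principle of the single big jump, made quantitative. Call `X i` a jump if
`|X i| > N / 8`, and write `cutoff (N / 8)` for truncation at that level.

* Two jumps have probability `O(n ^ 2 / N ^ 2)` by independence (`measure_two_jumps_le`).
* Without jumps the sum is a sum of truncated variables, with mean `O(n log N) = o(N)` and second
  moments `O(N)` per variable. The exponential Chebyshev inequality with tilt
  `h = 4 log (N / n) / N` gives `P(S > N) = O((n / N) ^ 2)` (`measure_sum_cutoff_ge_le`).
* With exactly one jump, at `i`, the event is `X i > N - T`, where `T` is the sum of the other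
  truncated variables and is independent of `X i`. Expanding the tail of `X i` to first order in
  `T` gives `P(X i > N) + p E[T] / N ^ 2 + O(E[T ^ 2] / N ^ 3 + 1 / N ^ 2)`
  (`abs_measure_shift_sub_le`, `abs_measure_jump_sub_le`). As `E[T] = O(n log N)` and
  `E[T ^ 2] = O(n N + (n log N) ^ 2)`, the correction is `O(n log N / N ^ 2)` for each `i`, and
  `O(n ^ 2 log N / N ^ 2)` in total.

The three cases are combined by the pointwise inequality `abs_indicator_sub_sum_jump_le`. The total
error is already `O(n ^ 2 (log N) ^ 2 / N ^ 2)`; the second error term is nonnegative. The lower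
tail is the upper tail of `-X`.
-/

/-! ### Truncation and truncated moments -/

/-- The truncation of a real number at level `y`: it is replaced by `0` once its absolute value
exceeds `y`. The truncated range is the closed interval `[-y, y]`. -/
noncomputable def cutoff (y x : ℝ) : ℝ := if |x| ≤ y then x else 0

lemma measurable_cutoff (y : ℝ) : Measurable (cutoff y) :=
  Measurable.ite (measurableSet_le measurable_id.abs measurable_const) measurable_id
    measurable_const

lemma abs_cutoff_le {y : ℝ} (hy : 0 ≤ y) (x : ℝ) : |cutoff y x| ≤ y := by
  unfold cutoff
  split_ifs with h
  · exact h
  · simpa using hy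

lemma abs_cutoff_le_abs (y x : ℝ) : |cutoff y x| ≤ |x| := by
  unfold cutoff
  split_ifs with h
  · exact le_rfl
  · simp

lemma cutoff_of_abs_le {y x : ℝ} (h : |x| ≤ y) : cutoff y x = x := if_pos h

section Moments

variable {Ω : Type*} [MeasurableSpace Ω] {μ : Measure Ω} [IsProbabilityMeasure μ]

lemma integrable_of_abs_le {f : Ω → ℝ} (hf : Measurable f) {B : ℝ} (hB : ∀ ω, |f ω| ≤ B) :
    Integrable f μ :=
  Integrable.of_bound hf.aestronglyMeasurable B (Eventually.of_forall hB)

lemma integral_abs_cutoff_le {X : Ω → ℝ} (hX : Measurable X) {M y : ℝ} (hy : 1 ≤ y)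
    (hM : ∀ u, 0 < u → μ.real {ω | u ≤ |X ω|} ≤ M / u) :
    ∫ ω, |cutoff y (X ω)| ∂μ ≤ 1 + M * Real.log y := by
  have hm : Measurable fun ω => cutoff y (X ω) := (measurable_cutoff y).comp hX
  have hb : ∀ ω, |cutoff y (X ω)| ≤ y := fun ω => abs_cutoff_le (by linarith) (X ω)
  rw [(integrable_of_abs_le hm hb).abs.integral_eq_integral_Ioc_meas_le
    (Eventually.of_forall fun ω => abs_nonneg _) (Eventually.of_forall hb),
    ← intervalIntegral.integral_of_le (by linarith)]
  set g : ℝ → ℝ := fun t => μ.real {ω | t ≤ |cutoff y (X ω)|} with hg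
  have hanti : Antitone g := fun s t hst =>
    measureReal_mono (fun ω (h : t ≤ _) => hst.trans h)
  have hgi : ∀ a b : ℝ, IntervalIntegrable g volume a b := fun a b => hanti.intervalIntegrable
  rw [← intervalIntegral.integral_add_adjacent_intervals (hgi 0 1) (hgi 1 y)]
  refine add_le_add ?_ ?_
  · calc ∫ t in (0 : ℝ)..1, g t ≤ ∫ t in (0 : ℝ)..1, (1 : ℝ) :=
          intervalIntegral.integral_mono_on (by norm_num) (hgi 0 1) intervalIntegrable_const
            fun t _ => measureReal_le_one
      _ = 1 := by simp
  · have hni : IntervalIntegrable (fun t : ℝ => M * t⁻¹) volume 1 y := by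
      refine (ContinuousOn.mul continuousOn_const
        (continuousOn_id.inv₀ fun t ht => ?_)).intervalIntegrable
      rw [Set.uIcc_of_le hy] at ht
      exact (lt_of_lt_of_le one_pos ht.1).ne'
    calc ∫ t in (1 : ℝ)..y, g t ≤ ∫ t in (1 : ℝ)..y, M * t⁻¹ := by
          refine intervalIntegral.integral_mono_on hy (hgi 1 y) hni fun t ht => ?_
          have := hM t (by linarith [ht.1])
          rw [div_eq_mul_inv] at this
          exact (measureReal_mono fun ω (h : t ≤ _) =>
            h.trans (abs_cutoff_le_abs _ _)).trans this
      _ = M * Real.log y := by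
          rw [intervalIntegral.integral_const_mul,
            integral_inv_of_pos one_pos (by linarith), div_one]

lemma cutoff_sq_le {y : ℝ} (hy : 0 ≤ y) (x : ℝ) : cutoff y x ^ 2 ≤ y ^ 2 :=
  sq_le_sq' (abs_le.1 (abs_cutoff_le hy x)).1 (abs_le.1 (abs_cutoff_le hy x)).2

lemma integrable_cutoff_sq {X : Ω → ℝ} (hX : Measurable X) {y : ℝ} (hy : 0 ≤ y) :
    Integrable (fun ω => cutoff y (X ω) ^ 2) μ :=
  integrable_of_abs_le (((measurable_cutoff y).comp hX).pow_const 2) fun ω => by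
    rw [abs_of_nonneg (sq_nonneg _)]; exact cutoff_sq_le hy (X ω)

lemma integral_cutoff_sq_le {X : Ω → ℝ} (hX : Measurable X) {M y : ℝ} (hy : 0 < y)
    (hM : ∀ u, 0 < u → μ.real {ω | u ≤ |X ω|} ≤ M / u) :
    ∫ ω, cutoff y (X ω) ^ 2 ∂μ ≤ 2 * M * y := by
  rw [(integrable_cutoff_sq hX hy.le).integral_eq_integral_Ioc_meas_le
    (Eventually.of_forall fun ω => sq_nonneg _)
    (Eventually.of_forall fun ω => cutoff_sq_le hy.le (X ω)),
    ← intervalIntegral.integral_of_le (by positivity)]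
  have hanti : Antitone fun t => μ.real {ω | t ≤ cutoff y (X ω) ^ 2} := fun s t hst =>
    measureReal_mono (fun ω (h : t ≤ _) => hst.trans h)
  calc ∫ t in (0 : ℝ)..(y ^ 2), μ.real {ω | t ≤ cutoff y (X ω) ^ 2}
      ≤ ∫ t in (0 : ℝ)..(y ^ 2), M * t ^ (-(1 / 2) : ℝ) := by
        refine intervalIntegral.integral_mono_on_of_le_Ioo (by positivity)
          hanti.intervalIntegrable
          ((intervalIntegral.intervalIntegrable_rpow' (by norm_num)).const_mul M) fun t ht => ?_
        have := hM (√t) (Real.sqrt_pos.2 ht.1)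
        rw [Real.rpow_neg ht.1.le, ← Real.sqrt_eq_rpow, ← div_eq_mul_inv]
        refine (measureReal_mono fun ω (h : t ≤ _) => ?_).trans this
        refine le_trans ?_ (abs_cutoff_le_abs y (X ω))
        rw [← Real.sqrt_sq_eq_abs]
        exact Real.sqrt_le_sqrt h
    _ = 2 * M * y := by
        rw [intervalIntegral.integral_const_mul, integral_rpow (Or.inl (by norm_num)),
          ← Real.rpow_natCast, ← Real.rpow_mul hy.le]
        norm_num
        ring

end Moments

/-! ### Sums without a jump -/

section SmallJumps

variable {Ω : Type*} [MeasurableSpace Ω] {μ : Measure Ω} [IsProbabilityMeasure μ]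

lemma exp_le_one_add_add_sq_mul (u : ℝ) :
    Real.exp u ≤ 1 + u + u ^ 2 * Real.exp |u| := by
  have h := Complex.norm_exp_sub_sum_le_norm_mul_exp (u : ℂ) 2
  have h2 : Complex.exp u - ∑ m ∈ Finset.range 2, (u : ℂ) ^ m / (m.factorial : ℂ)
      = ((Real.exp u - (1 + u) : ℝ) : ℂ) := by
    simp [Finset.sum_range_succ]
  rw [h2, Complex.norm_real, Complex.norm_real, Real.norm_eq_abs, Real.norm_eq_abs, sq_abs] at h
  linarith [le_abs_self (Real.exp u - (1 + u))]

lemma mgf_cutoff_le {X : Ω → ℝ} (hX : Measurable X) {y h m V : ℝ} (hy : 0 ≤ y) (hh : 0 ≤ h)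
    (hm : ∫ ω, |cutoff y (X ω)| ∂μ ≤ m) (hV : ∫ ω, cutoff y (X ω) ^ 2 ∂μ ≤ V) :
    mgf (fun ω => cutoff y (X ω)) μ h ≤ Real.exp (h * m + h ^ 2 * Real.exp (h * y) * V) := by
  have hmeas : Measurable fun ω => cutoff y (X ω) := (measurable_cutoff y).comp hX
  have hb : ∀ ω, |cutoff y (X ω)| ≤ y := fun ω => abs_cutoff_le hy (X ω)
  have i1 : Integrable (fun ω => cutoff y (X ω)) μ := integrable_of_abs_le hmeas hb
  have i2 : Integrable (fun ω => cutoff y (X ω) ^ 2) μ := integrable_cutoff_sq hX hy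
  have i3 : Integrable (fun ω => Real.exp (h * cutoff y (X ω))) μ :=
    integrable_of_abs_le (B := Real.exp (h * y)) (by fun_prop) fun ω => by
      rw [abs_of_pos (Real.exp_pos _)]
      exact Real.exp_le_exp.2 (mul_le_mul_of_nonneg_left (abs_le.1 (hb ω)).2 hh)
  have hpt : ∀ ω, Real.exp (h * cutoff y (X ω)) ≤
      1 + h * |cutoff y (X ω)| + h ^ 2 * Real.exp (h * y) * cutoff y (X ω) ^ 2 := by
    intro ω
    have e1 := exp_le_one_add_add_sq_mul (h * cutoff y (X ω))
    have e2 : Real.exp |h * cutoff y (X ω)| ≤ Real.exp (h * y) := by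
      rw [abs_mul, abs_of_nonneg hh]
      exact Real.exp_le_exp.2 (mul_le_mul_of_nonneg_left (hb ω) hh)
    have e3 := mul_le_mul_of_nonneg_left e2 (sq_nonneg (h * cutoff y (X ω)))
    have e4 := mul_le_mul_of_nonneg_left (le_abs_self (cutoff y (X ω))) hh
    nlinarith
  calc mgf (fun ω => cutoff y (X ω)) μ h
      ≤ ∫ ω, (1 + h * |cutoff y (X ω)| + h ^ 2 * Real.exp (h * y) * cutoff y (X ω) ^ 2) ∂μ :=
        integral_mono i3 (((integrable_const 1).add (i1.abs.const_mul h)).add (i2.const_mul _)) hpt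
    _ = 1 + h * ∫ ω, |cutoff y (X ω)| ∂μ
        + h ^ 2 * Real.exp (h * y) * ∫ ω, cutoff y (X ω) ^ 2 ∂μ := by
        rw [integral_add (by fun_prop) (by fun_prop), integral_add (by fun_prop) (by fun_prop),
          integral_const_mul, integral_const_mul]
        simp
    _ ≤ (h * m + h ^ 2 * Real.exp (h * y) * V) + 1 := by
        have e1 := mul_le_mul_of_nonneg_left hm hh
        have e2 := mul_le_mul_of_nonneg_left hV
          (mul_nonneg (sq_nonneg h) (Real.exp_pos (h * y)).le)
        linarith
    _ ≤ _ := Real.add_one_le_exp _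

/-- Without a summand larger than `N / 8`, the sum exceeds `N` only with probability of order
`(n / N) ^ 2`. -/
lemma measure_sum_cutoff_ge_le {X : ℕ → Ω → ℝ} (hX : ∀ i, Measurable (X i))
    (hindep : iIndepFun X μ) {M N : ℝ} (hM0 : 0 ≤ M) (hN : 8 ≤ N) {n : ℕ} (hn : 1 ≤ n)
    (hnN : n * ((1 + M) * Real.log N) ≤ N / 2) (hlog : 1 ≤ Real.log N)
    (hM : ∀ i u, 0 < u → μ.real {ω | u ≤ |X i ω|} ≤ M / u) :
    μ.real {ω | N ≤ ∑ i ∈ Finset.range n, cutoff (N / 8) (X i ω)}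
      ≤ Real.exp (64 * M) * (n / N) ^ 2 := by
  have hN0 : 0 < N := by linarith
  have hn0 : (0 : ℝ) < n := by exact_mod_cast hn
  have hn_le : (n : ℝ) ≤ N := by
    have : (n : ℝ) * 1 ≤ n * ((1 + M) * Real.log N) :=
      mul_le_mul_of_nonneg_left (by nlinarith) hn0.le
    linarith
  -- The tilt `h` is chosen so that `exp (h * (N / 8))` is the square root of `N / n`.
  set L := Real.log (N / n) with hL
  have hexpL : Real.exp L = N / n := Real.exp_log (by positivity)
  have hL0 : 0 ≤ L := Real.log_nonneg (by rwa [le_div_iff₀ hn0, one_mul])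
  set h := 4 * L / N with hh
  have hh0 : 0 ≤ h := by positivity
  set m := (1 + M) * Real.log N with hm
  set V := 2 * M * (N / 8) with hV
  have hmoment : ∀ i, ∫ ω, |cutoff (N / 8) (X i ω)| ∂μ ≤ m := fun i =>
    (integral_abs_cutoff_le (hX i) (by linarith) (hM i)).trans <| by
      have : Real.log (N / 8) ≤ Real.log N := Real.log_le_log (by linarith) (by linarith)
      nlinarith
  have hmgf : ∀ i, mgf (fun ω => cutoff (N / 8) (X i ω)) μ h
      ≤ Real.exp (h * m + h ^ 2 * Real.exp (h * (N / 8)) * V) := fun i =>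
    mgf_cutoff_le (hX i) (by linarith) hh0 (hmoment i)
      (integral_cutoff_sq_le (hX i) (by linarith) (hM i))
  have hind : iIndepFun (fun i ω => cutoff (N / 8) (X i ω)) μ :=
    hindep.comp (fun _ => cutoff (N / 8)) fun _ => measurable_cutoff _
  have hmeas : ∀ i, Measurable fun ω => cutoff (N / 8) (X i ω) := fun i =>
    (measurable_cutoff _).comp (hX i)
  have hsum : (fun ω => ∑ i ∈ Finset.range n, cutoff (N / 8) (X i ω))
      = ∑ i ∈ Finset.range n, fun ω => cutoff (N / 8) (X i ω) := by
    ext ω; simp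
  have hint : Integrable
      (fun ω => Real.exp (h * ∑ i ∈ Finset.range n, cutoff (N / 8) (X i ω))) μ := by
    refine integrable_of_abs_le (B := Real.exp (h * (n * (N / 8)))) (by fun_prop) fun ω => ?_
    rw [abs_of_pos (Real.exp_pos _)]
    refine Real.exp_le_exp.2 (mul_le_mul_of_nonneg_left ?_ hh0)
    calc ∑ i ∈ Finset.range n, cutoff (N / 8) (X i ω)
        ≤ ∑ i ∈ Finset.range n, N / 8 := Finset.sum_le_sum fun i _ =>
          (abs_le.1 (abs_cutoff_le (by linarith) (X i ω))).2
      _ = n * (N / 8) := by simp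
  refine (measure_ge_le_exp_mul_mgf N hh0 hint).trans ?_
  rw [hsum, hind.mgf_sum hmeas]
  calc Real.exp (-h * N) * ∏ i ∈ Finset.range n, mgf (fun ω => cutoff (N / 8) (X i ω)) μ h
      ≤ Real.exp (-h * N) *
        ∏ i ∈ Finset.range n, Real.exp (h * m + h ^ 2 * Real.exp (h * (N / 8)) * V) := by
        gcongr with i _
        · exact fun i _ => mgf_nonneg
        · exact hmgf i
    _ = Real.exp (-h * N + n * (h * m + h ^ 2 * Real.exp (h * (N / 8)) * V)) := by
        rw [Finset.prod_const, Finset.card_range, ← Real.exp_nat_mul, ← Real.exp_add]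
    _ ≤ Real.exp (64 * M + -(2 * L)) := by
        refine Real.exp_le_exp.2 ?_
        have e1 : h * N = 4 * L := by rw [hh]; field_simp
        have e2 : h * (n * m) ≤ h * (N / 2) := mul_le_mul_of_nonneg_left hnN hh0
        have e3 : n * (h ^ 2 * Real.exp (h * (N / 8)) * V)
            = 4 * M * (L ^ 2 * (Real.exp (L / 2) * (n / N))) := by
          have : h * (N / 8) = L / 2 := by rw [hh]; field_simp; ring
          rw [this, hV, hh]; field_simp; ring
        have e4 : (n : ℝ) / N = Real.exp (-L) := by rw [Real.exp_neg, hexpL, inv_div]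
        have e5 : Real.exp (L / 2) * (n / N) = Real.exp (-(L / 4)) ^ 2 := by
          rw [e4, ← Real.exp_add, ← Real.exp_nat_mul]; congr 1; push_cast; ring
        have e6 : L * Real.exp (-(L / 4)) ≤ 4 := by
          rw [Real.exp_neg, ← div_eq_mul_inv, div_le_iff₀ (Real.exp_pos _)]
          linarith [Real.add_one_le_exp (L / 4)]
        have e7 : (L * Real.exp (-(L / 4))) ^ 2 ≤ 4 ^ 2 := by gcongr
        rw [e5, ← mul_pow] at e3
        have e8 : 4 * M * (L * Real.exp (-(L / 4))) ^ 2 ≤ 4 * M * 4 ^ 2 :=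
          mul_le_mul_of_nonneg_left e7 (by positivity)
        linarith
    _ = Real.exp (64 * M) * (n / N) ^ 2 := by
        rw [Real.exp_add]
        congr 1
        have e4 : (n : ℝ) / N = Real.exp (-L) := by rw [Real.exp_neg, hexpL, inv_div]
        rw [e4, ← Real.exp_nat_mul]; congr 1; push_cast; ring

end SmallJumps

/-! ### A single jump -/

section BigJump

variable {Ω : Type*} [MeasurableSpace Ω] {μ : Measure Ω} [IsProbabilityMeasure μ]

/-- First-order expansion of the tail at `N - t`, with a remainder that is quadratic in the shift.
The remainder is integrated later against the law of a sum of truncated variables, so the linear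
term has to be kept with its sign: only the mean of the shift is small. -/
lemma abs_measure_shift_sub_le {X : Ω → ℝ} {M N p : ℝ} (hp0 : 0 ≤ p) (hp1 : p ≤ 1)
    (hN : 0 < N)
    (hM : ∀ u, 0 < u → μ.real {ω | u ≤ |X ω|} ≤ M / u)
    (htail : ∀ u, 0 < u → |μ.real {ω | u < X ω} - p / u| ≤ M / u ^ 2) (t : ℝ) :
    |μ.real {ω | N - t < X ω ∧ N / 8 < |X ω|} - μ.real {ω | N < X ω} - p / N ^ 2 * t|
      ≤ (32 * M + 2) / N ^ 3 * t ^ 2 + 5 * M / N ^ 2 := by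
  have hM0 : 0 ≤ M := by
    have := (abs_nonneg _).trans (htail 1 one_pos)
    simpa using this
  by_cases ht : |t| ≤ N / 2
  · have ht' := abs_le.1 ht
    have hNt : 0 < N - t := by linarith
    have hset : {ω | N - t < X ω ∧ N / 8 < |X ω|} = {ω | N - t < X ω} := by
      ext ω
      refine ⟨fun h => h.1, fun h => ⟨h, ?_⟩⟩
      have h' : N - t < X ω := h
      exact lt_of_lt_of_le (by linarith) (le_abs_self _)
    rw [hset]
    have h1 := htail (N - t) hNt
    have h2 := htail N hN
    have h3 : M / (N - t) ^ 2 ≤ 4 * M / N ^ 2 := by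
      rw [div_le_div_iff₀ (by positivity) (by positivity)]
      nlinarith [mul_le_mul_of_nonneg_left
        (show N ^ 2 ≤ 4 * (N - t) ^ 2 by nlinarith) hM0]
    have h4 : p / (N - t) - p / N - p / N ^ 2 * t = p * t ^ 2 / (N ^ 2 * (N - t)) := by
      field_simp; ring
    have h5 : p * t ^ 2 / (N ^ 2 * (N - t)) ≤ 2 / N ^ 3 * t ^ 2 := by
      rw [div_mul_eq_mul_div, div_le_div_iff₀ (by positivity) (by positivity)]
      have : p * N ≤ 2 * (N - t) := by nlinarith
      nlinarith [mul_le_mul_of_nonneg_left this (show 0 ≤ t ^ 2 * N ^ 2 by positivity)]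
    have h6 : 0 ≤ p * t ^ 2 / (N ^ 2 * (N - t)) := by positivity
    have h7 : (32 * M + 2) / N ^ 3 * t ^ 2 = 32 * M / N ^ 3 * t ^ 2 + 2 / N ^ 3 * t ^ 2 := by ring
    have h8 : 0 ≤ 32 * M / N ^ 3 * t ^ 2 := by positivity
    have h9 : 5 * M / N ^ 2 = 4 * M / N ^ 2 + M / N ^ 2 := by ring
    rw [abs_le] at h1 h2 ⊢
    constructor <;> linarith [h1.1, h1.2, h2.1, h2.2]
  · rw [not_le] at ht
    have ht2 : N ^ 2 ≤ 4 * t ^ 2 := by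
      rw [← sq_abs t]; nlinarith
    have h1 : μ.real {ω | N - t < X ω ∧ N / 8 < |X ω|} ≤ 8 * M / N := by
      refine (measureReal_mono fun ω h => le_of_lt h.2).trans ((hM (N / 8) (by linarith)).trans ?_)
      rw [div_div_eq_mul_div, mul_comm]
    have h2 : μ.real {ω | N < X ω} ≤ 8 * M / N := by
      refine (measureReal_mono fun ω (h : N < X ω) => ?_).trans ((hM N hN).trans ?_)
      · exact h.le.trans (le_abs_self _)
      · gcongr; linarith
    have h3 : 8 * M / N ≤ 32 * M / N ^ 3 * t ^ 2 := by
      rw [div_mul_eq_mul_div, div_le_div_iff₀ hN (by positivity)]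
      nlinarith [mul_le_mul_of_nonneg_left ht2 (show 0 ≤ M * N by positivity)]
    have h4 : |p / N ^ 2 * t| ≤ 2 / N ^ 3 * t ^ 2 := by
      rw [abs_mul, abs_of_nonneg (by positivity), div_mul_eq_mul_div, div_mul_eq_mul_div,
        div_le_div_iff₀ (by positivity) (by positivity), ← sq_abs t]
      have : p * N ≤ 2 * |t| := by nlinarith
      nlinarith [mul_le_mul_of_nonneg_left this (show 0 ≤ |t| * N ^ 2 by positivity)]
    have h5 : 0 ≤ 5 * M / N ^ 2 := by positivity
    have h7 : (32 * M + 2) / N ^ 3 * t ^ 2 = 32 * M / N ^ 3 * t ^ 2 + 2 / N ^ 3 * t ^ 2 := by ring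
    have h8 : 0 ≤ μ.real {ω | N - t < X ω ∧ N / 8 < |X ω|} := measureReal_nonneg
    have h9 : 0 ≤ μ.real {ω | N < X ω} := measureReal_nonneg
    rw [abs_le] at h4 ⊢
    constructor <;> linarith [h4.1, h4.2]

lemma measure_eq_integral_of_indepFun {X T : Ω → ℝ} (hX : Measurable X) (hT : Measurable T)
    (h : IndepFun X T μ) (N y : ℝ) :
    Integrable (fun ω => μ.real {ω' | N - T ω < X ω' ∧ y < |X ω'|}) μ ∧
    μ.real {ω | N - T ω < X ω ∧ y < |X ω|}
      = ∫ ω, μ.real {ω' | N - T ω < X ω' ∧ y < |X ω'|} ∂μ := by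
  have hB : MeasurableSet {z : ℝ × ℝ | N - z.2 < z.1 ∧ y < |z.1|} :=
    measurableSet_setOfPred.2 (((measurableSet_lt (measurable_const.sub measurable_snd)
      measurable_fst).mem).and (measurableSet_lt measurable_const measurable_fst.abs).mem)
  have hsec : ∀ t, μ.map X ((fun x => (x, t)) ⁻¹' {z : ℝ × ℝ | N - z.2 < z.1 ∧ y < |z.1|})
      = μ {ω | N - t < X ω ∧ y < |X ω|} := fun t => by
    rw [Measure.map_apply hX (measurable_prodMk_right hB)]; rfl
  have := Measure.isProbabilityMeasure_map (μ := μ) hX.aemeasurable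
  have hmeas : Measurable fun t : ℝ => μ {ω | N - t < X ω ∧ y < |X ω|} := by
    simp_rw [← hsec]; exact measurable_measure_prodMk_right hB
  have hmeasT : Measurable fun ω => μ {ω' | N - T ω < X ω' ∧ y < |X ω'|} := hmeas.comp hT
  refine ⟨integrable_of_abs_le (B := 1) hmeasT.ennreal_toReal fun ω => ?_, ?_⟩
  · rw [abs_of_nonneg measureReal_nonneg]; exact measureReal_le_one
  · have hE : μ {ω | N - T ω < X ω ∧ y < |X ω|}
        = ∫⁻ ω, μ {ω' | N - T ω < X ω' ∧ y < |X ω'|} ∂μ := by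
      have e1 : μ {ω | N - T ω < X ω ∧ y < |X ω|}
          = μ.map (fun ω => (X ω, T ω)) {z : ℝ × ℝ | N - z.2 < z.1 ∧ y < |z.1|} := by
        rw [Measure.map_apply (hX.prodMk hT) hB]; rfl
      rw [e1, (indepFun_iff_map_prod_eq_prod_map_map hX.aemeasurable hT.aemeasurable).1 h,
        Measure.prod_apply_symm hB]
      simp_rw [hsec]
      rw [lintegral_map hmeas hT]
    rw [measureReal_def, hE, ← integral_toReal hmeasT.aemeasurable
      (Eventually.of_forall fun ω => measure_lt_top _ _)]
    rfl

/-- Probability that a single large variable `X`, helped by an independent sum `T` of the other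
variables, exceeds `N`. -/
lemma abs_measure_jump_sub_le {X T : Ω → ℝ} (hX : Measurable X) (hT : Measurable T)
    (h : IndepFun X T μ) {M N p m W : ℝ} (hp0 : 0 ≤ p) (hp1 : p ≤ 1) (hN : 0 < N)
    (hM : ∀ u, 0 < u → μ.real {ω | u ≤ |X ω|} ≤ M / u)
    (htail : ∀ u, 0 < u → |μ.real {ω | u < X ω} - p / u| ≤ M / u ^ 2)
    (hT2 : MemLp T 2 μ) (hm : |∫ ω, T ω ∂μ| ≤ m) (hW : ∫ ω, T ω ^ 2 ∂μ ≤ W) :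
    |μ.real {ω | N - T ω < X ω ∧ N / 8 < |X ω|} - μ.real {ω | N < X ω}|
      ≤ m / N ^ 2 + (32 * M + 2) / N ^ 3 * W + 5 * M / N ^ 2 := by
  have hM0 : 0 ≤ M := by
    have := (abs_nonneg _).trans (htail 1 one_pos)
    simpa using this
  obtain ⟨iF, hF⟩ := measure_eq_integral_of_indepFun hX hT h N (N / 8)
  have iT : Integrable T μ := hT2.integrable (by norm_num)
  have iT2 : Integrable (fun ω => T ω ^ 2) μ := hT2.integrable_sq
  set F : Ω → ℝ := fun ω => μ.real {ω' | N - T ω < X ω' ∧ N / 8 < |X ω'|} with hFdef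
  have e1 : |∫ ω, (F ω - μ.real {ω | N < X ω} - p / N ^ 2 * T ω) ∂μ|
      ≤ ∫ ω, ((32 * M + 2) / N ^ 3 * T ω ^ 2 + 5 * M / N ^ 2) ∂μ :=
    norm_integral_le_of_norm_le (f := fun ω => F ω - μ.real {ω | N < X ω} - p / N ^ 2 * T ω)
      (g := fun ω => (32 * M + 2) / N ^ 3 * T ω ^ 2 + 5 * M / N ^ 2)
      ((iT2.const_mul _).add (integrable_const _))
      (Eventually.of_forall fun ω => abs_measure_shift_sub_le hp0 hp1 hN hM htail (T ω))
  have iC : Integrable (fun _ : Ω => μ.real {ω | N < X ω}) μ := integrable_const _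
  rw [integral_sub (by exact iF.sub iC) (iT.const_mul _), integral_sub iF iC, integral_const_mul,
    integral_add (iT2.const_mul _) (integrable_const _), integral_const_mul] at e1
  simp only [integral_const, probReal_univ, one_smul] at e1
  have e2 : |p / N ^ 2 * ∫ ω, T ω ∂μ| ≤ m / N ^ 2 := by
    rw [abs_mul, abs_of_nonneg (by positivity), div_mul_eq_mul_div]
    gcongr
    nlinarith [abs_nonneg (∫ ω, T ω ∂μ)]
  have e3 : (32 * M + 2) / N ^ 3 * ∫ ω, T ω ^ 2 ∂μ ≤ (32 * M + 2) / N ^ 3 * W :=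
    mul_le_mul_of_nonneg_left hW (by positivity)
  rw [hF]
  rw [abs_le] at e1 e2 ⊢
  constructor <;> linarith [e1.1, e1.2, e2.1, e2.2]

lemma abs_integral_sum_cutoff_le {X : ℕ → Ω → ℝ} (hX : ∀ i, Measurable (X i))
    (s : Finset ℕ) {y m : ℝ} (hy : 0 ≤ y) (hm : ∀ i, ∫ ω, |cutoff y (X i ω)| ∂μ ≤ m) :
    |∫ ω, ∑ i ∈ s, cutoff y (X i ω) ∂μ| ≤ s.card * m := by
  have hi : ∀ i, Integrable (fun ω => cutoff y (X i ω)) μ := fun i =>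
    integrable_of_abs_le ((measurable_cutoff y).comp (hX i)) fun ω => abs_cutoff_le hy _
  rw [integral_finsetSum _ fun i _ => hi i]
  calc |∑ i ∈ s, ∫ ω, cutoff y (X i ω) ∂μ|
      ≤ ∑ i ∈ s, |∫ ω, cutoff y (X i ω) ∂μ| := Finset.abs_sum_le_sum_abs _ _
    _ ≤ ∑ i ∈ s, m := Finset.sum_le_sum fun i _ => abs_integral_le_integral_abs.trans (hm i)
    _ = s.card * m := by simp

lemma memLp_sum_cutoff {X : ℕ → Ω → ℝ} (hX : ∀ i, Measurable (X i)) (s : Finset ℕ) {y : ℝ}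
    (hy : 0 ≤ y) : MemLp (fun ω => ∑ i ∈ s, cutoff y (X i ω)) 2 μ :=
  memLp_finsetSum _ fun i _ => MemLp.of_bound
    ((measurable_cutoff y).comp (hX i)).aestronglyMeasurable y
    (Eventually.of_forall fun ω => abs_cutoff_le hy (X i ω))

lemma integral_sq_sum_cutoff_le {X : ℕ → Ω → ℝ} (hX : ∀ i, Measurable (X i))
    (hindep : iIndepFun X μ) (s : Finset ℕ) {y m V : ℝ} (hy : 0 ≤ y)
    (hm : ∀ i, ∫ ω, |cutoff y (X i ω)| ∂μ ≤ m) (hV : ∀ i, ∫ ω, cutoff y (X i ω) ^ 2 ∂μ ≤ V) :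
    ∫ ω, (∑ i ∈ s, cutoff y (X i ω)) ^ 2 ∂μ ≤ s.card * V + (s.card * m) ^ 2 := by
  have hmeas : ∀ i, Measurable fun ω => cutoff y (X i ω) := fun i =>
    (measurable_cutoff y).comp (hX i)
  have hL : ∀ i, MemLp (fun ω => cutoff y (X i ω)) 2 μ := fun i =>
    MemLp.of_bound (hmeas i).aestronglyMeasurable y
      (Eventually.of_forall fun ω => abs_cutoff_le hy (X i ω))
  have hind : iIndepFun (fun i ω => cutoff y (X i ω)) μ :=
    hindep.comp (fun _ => cutoff y) fun _ => measurable_cutoff _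
  have h1 := variance_eq_sub (memLp_sum_cutoff (μ := μ) hX s hy)
  have h2 := IndepFun.variance_sum (μ := μ) (s := s) (X := fun i ω => cutoff y (X i ω))
    (fun i _ => hL i) fun i _ j _ hij => hind.indepFun hij
  have hsum : (fun ω => ∑ i ∈ s, cutoff y (X i ω)) = ∑ i ∈ s, fun ω => cutoff y (X i ω) := by
    ext ω; simp
  rw [← hsum] at h2
  have h3 : ∑ i ∈ s, Var[fun ω => cutoff y (X i ω); μ] ≤ s.card * V := by
    calc _ ≤ ∑ i ∈ s, V := Finset.sum_le_sum fun i _ =>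
          (variance_le_expectation_sq (hmeas i).aestronglyMeasurable).trans (hV i)
      _ = s.card * V := by simp
  have h4 : (∫ ω, ∑ i ∈ s, cutoff y (X i ω) ∂μ) ^ 2 ≤ (s.card * m) ^ 2 := by
    rw [← sq_abs]
    exact pow_le_pow_left₀ (abs_nonneg _) (abs_integral_sum_cutoff_le hX s hy hm) 2
  simp only [Pi.pow_apply] at h1
  linarith

omit [IsProbabilityMeasure μ] in
lemma indepFun_sum_erase_cutoff {X : ℕ → Ω → ℝ} (hX : ∀ i, Measurable (X i))
    (hindep : iIndepFun X μ) (s : Finset ℕ) (i : ℕ) (y : ℝ) :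
    IndepFun (X i) (fun ω => ∑ j ∈ s.erase i, cutoff y (X j ω)) μ := by
  have h := hindep.indepFun_finset {i} (s.erase i) (by simp) hX
  have hφ : Measurable fun z : (({i} : Finset ℕ) → ℝ) => z ⟨i, by simp⟩ := measurable_pi_apply _
  have h' := h.comp (ψ := fun z : (s.erase i → ℝ) => ∑ j, cutoff y (z j)) hφ
    (Finset.measurable_sum _ fun j _ => (measurable_cutoff y).comp (measurable_pi_apply j))
  have hsum : (fun ω => ∑ j ∈ s.erase i, cutoff y (X j ω))
      = (fun z : (s.erase i → ℝ) => ∑ j, cutoff y (z j)) ∘ fun ω j => X j ω := by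
    ext ω
    exact (Finset.sum_coe_sort (s.erase i) fun j => cutoff y (X j ω)).symm
  rw [hsum]
  exact h'

end BigJump

/-! ### The single-big-jump estimate -/

/-- Comparison of the event `N < ∑ x` with the single-jump events. If no term exceeds `y`, the sum
agrees with the truncated sum; if exactly one does, the two counts agree; and if `k ≥ 2` terms do,
the difference is at most `k`, hence at most the number `k * (k - 1)` of ordered pairs of jumps. -/
lemma abs_indicator_sub_sum_jump_le (s : Finset ℕ) (x : ℕ → ℝ) (N y : ℝ) :
    |(if N < ∑ i ∈ s, x i then (1 : ℝ) else 0)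
      - ∑ i ∈ s, if N - ∑ j ∈ s.erase i, cutoff y (x j) < x i ∧ y < |x i| then (1 : ℝ) else 0|
    ≤ (if N ≤ ∑ i ∈ s, cutoff y (x i) then (1 : ℝ) else 0)
      + ∑ i ∈ s, ∑ j ∈ s.erase i, if y < |x i| ∧ y < |x j| then (1 : ℝ) else 0 := by
  set J := s.filter fun i => y < |x i| with hJ
  have hpairs : ∑ i ∈ s, ∑ j ∈ s.erase i, (if y < |x i| ∧ y < |x j| then (1 : ℝ) else 0)
      = J.card * (J.card - 1) := by
    calc ∑ i ∈ s, ∑ j ∈ s.erase i, (if y < |x i| ∧ y < |x j| then (1 : ℝ) else 0)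
        = ∑ i ∈ s, if y < |x i| then ((J.card : ℝ) - 1) else 0 := by
          refine Finset.sum_congr rfl fun i hi => ?_
          split_ifs with h
          · have hiJ : i ∈ J := Finset.mem_filter.2 ⟨hi, h⟩
            simp only [h, true_and]
            rw [← Finset.sum_filter, Finset.sum_const, nsmul_eq_mul, mul_one,
              Finset.filter_erase, ← hJ, Finset.card_erase_of_mem hiJ,
              Nat.cast_sub (Finset.card_pos.2 ⟨i, hiJ⟩), Nat.cast_one]
          · simp [h]
      _ = J.card * (J.card - 1) := by
          rw [← Finset.sum_filter, Finset.sum_const, nsmul_eq_mul]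
  have hjump : ∑ i ∈ s, (if N - ∑ j ∈ s.erase i, cutoff y (x j) < x i ∧ y < |x i|
      then (1 : ℝ) else 0)
      = ∑ i ∈ J, if N - ∑ j ∈ s.erase i, cutoff y (x j) < x i then (1 : ℝ) else 0 := by
    rw [hJ, Finset.sum_filter]
    refine Finset.sum_congr rfl fun i _ => ?_
    by_cases h : y < |x i| <;> simp [h]
  have hbig : 0 ≤ (if N ≤ ∑ i ∈ s, cutoff y (x i) then (1 : ℝ) else 0) := by
    split_ifs <;> norm_num
  rw [hpairs, hjump]
  rcases Nat.lt_trichotomy J.card 1 with h0 | h1 | h2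
  · have hJ0 : J = ∅ := Finset.card_eq_zero.1 (by omega)
    have hc : ∑ i ∈ s, cutoff y (x i) = ∑ i ∈ s, x i :=
      Finset.sum_congr rfl fun i hi => cutoff_of_abs_le <| not_lt.1 fun h => by
        have : i ∈ J := Finset.mem_filter.2 ⟨hi, h⟩
        simp [hJ0] at this
    rw [hJ0, hc]
    by_cases hN : N < ∑ i ∈ s, x i
    · simp [hN, hN.le]
    · simp only [hN, if_false, Finset.sum_empty, Finset.card_empty]
      split_ifs <;> simp
  · obtain ⟨i, hi⟩ := Finset.card_eq_one.1 h1
    have hiJ : i ∈ J := by simp [hi]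
    have his : i ∈ s := (Finset.mem_filter.1 hiJ).1
    have hc : ∑ j ∈ s.erase i, cutoff y (x j) = ∑ j ∈ s.erase i, x j :=
      Finset.sum_congr rfl fun j hj => cutoff_of_abs_le <| not_lt.1 fun h => by
        have : j ∈ J := Finset.mem_filter.2 ⟨(Finset.mem_erase.1 hj).2, h⟩
        rw [hi, Finset.mem_singleton] at this
        exact (Finset.mem_erase.1 hj).1 this
    have hiff : N - ∑ j ∈ s.erase i, x j < x i ↔ N < ∑ j ∈ s, x j := by
      rw [← Finset.add_sum_erase s x his, sub_lt_iff_lt_add]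
    rw [hi, Finset.sum_singleton, hc, if_congr hiff rfl rfl, sub_self]
    simpa using hbig
  · have hk : (2 : ℝ) ≤ J.card := by exact_mod_cast h2
    have hlow : 0 ≤ ∑ i ∈ J, (if N - ∑ j ∈ s.erase i, cutoff y (x j) < x i
        then (1 : ℝ) else 0) := Finset.sum_nonneg fun i _ => by split_ifs <;> norm_num
    have hup : ∑ i ∈ J, (if N - ∑ j ∈ s.erase i, cutoff y (x j) < x i
        then (1 : ℝ) else 0) ≤ J.card := by
      calc _ ≤ ∑ i ∈ J, (1 : ℝ) := Finset.sum_le_sum fun i _ => by split_ifs <;> norm_num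
        _ = J.card := by simp
    have hA : (if N < ∑ i ∈ s, x i then (1 : ℝ) else 0) ≤ 1 := by split_ifs <;> norm_num
    have hA' : 0 ≤ (if N < ∑ i ∈ s, x i then (1 : ℝ) else 0) := by split_ifs <;> norm_num
    rw [abs_le]
    constructor <;> nlinarith

section Sum

variable {Ω : Type*} [MeasurableSpace Ω] {μ : Measure Ω} [IsProbabilityMeasure μ]

lemma abs_measure_sum_sub_sum_jump_le {X : ℕ → Ω → ℝ} (hX : ∀ i, Measurable (X i))
    (s : Finset ℕ) (N y : ℝ) :
    |μ.real {ω | N < ∑ i ∈ s, X i ω}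
      - ∑ i ∈ s, μ.real {ω | N - ∑ j ∈ s.erase i, cutoff y (X j ω) < X i ω ∧ y < |X i ω|}|
    ≤ μ.real {ω | N ≤ ∑ i ∈ s, cutoff y (X i ω)}
      + ∑ i ∈ s, ∑ j ∈ s.erase i, μ.real {ω | y < |X i ω| ∧ y < |X j ω|} := by
  have key : ∀ {q : Ω → Prop} [DecidablePred q] (_ : MeasurableSet {ω | q ω}),
      Integrable (fun ω => if q ω then (1 : ℝ) else 0) μ ∧
      ∫ ω, (if q ω then (1 : ℝ) else 0) ∂μ = μ.real {ω | q ω} := by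
    intro q _ hq
    have e : (fun ω => if q ω then (1 : ℝ) else 0) = Set.indicator {ω | q ω} 1 := by
      ext ω; simp [Set.indicator_apply]
    rw [e]
    exact ⟨(integrable_const (1 : ℝ)).indicator hq, integral_indicator_one hq⟩
  have hc : ∀ i, Measurable fun ω => cutoff y (X i ω) := fun i =>
    (measurable_cutoff y).comp (hX i)
  have mA : MeasurableSet {ω | N < ∑ i ∈ s, X i ω} :=
    measurableSet_lt measurable_const (by fun_prop)
  have mB : MeasurableSet {ω | N ≤ ∑ i ∈ s, cutoff y (X i ω)} :=
    measurableSet_le measurable_const (by fun_prop)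
  have mE : ∀ i, MeasurableSet
      {ω | N - ∑ j ∈ s.erase i, cutoff y (X j ω) < X i ω ∧ y < |X i ω|} := fun i =>
    measurableSet_setOfPred.2 ((measurableSet_lt (by fun_prop) (hX i)).mem.and
      (measurableSet_lt measurable_const (hX i).abs).mem)
  have mP : ∀ i j, MeasurableSet {ω | y < |X i ω| ∧ y < |X j ω|} := fun i j =>
    measurableSet_setOfPred.2 ((measurableSet_lt measurable_const (hX i).abs).mem.and
      (measurableSet_lt measurable_const (hX j).abs).mem)
  have iE := integrable_finsetSum s fun i _ => (key (mE i)).1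
  have iP := integrable_finsetSum s fun i _ =>
    integrable_finsetSum (s.erase i) fun j _ => (key (mP i j)).1
  have h := norm_integral_le_of_norm_le
    (f := fun ω => (if N < ∑ i ∈ s, X i ω then (1 : ℝ) else 0)
      - ∑ i ∈ s, if N - ∑ j ∈ s.erase i, cutoff y (X j ω) < X i ω ∧ y < |X i ω|
        then (1 : ℝ) else 0)
    (g := fun ω => (if N ≤ ∑ i ∈ s, cutoff y (X i ω) then (1 : ℝ) else 0)
      + ∑ i ∈ s, ∑ j ∈ s.erase i, if y < |X i ω| ∧ y < |X j ω| then (1 : ℝ) else 0)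
    ((key mB).1.add iP)
    (Eventually.of_forall fun ω => abs_indicator_sub_sum_jump_le s (fun i => X i ω) N y)
  rw [integral_sub (key mA).1 iE, integral_finsetSum _ fun i _ => (key (mE i)).1] at h
  rw [integral_add (key mB).1 iP, integral_finsetSum _ fun i _ =>
    integrable_finsetSum (s.erase i) fun j _ => (key (mP i j)).1, (key mA).2, (key mB).2] at h
  simp_rw [(key (mE _)).2] at h
  rw [Real.norm_eq_abs] at h
  refine h.trans (le_of_eq ?_)
  congr 1
  refine Finset.sum_congr rfl fun i _ => ?_
  rw [integral_finsetSum _ fun j _ => (key (mP i j)).1]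
  exact Finset.sum_congr rfl fun j _ => (key (mP i j)).2

lemma measure_two_jumps_le {X : ℕ → Ω → ℝ} (hindep : iIndepFun X μ) {M N : ℝ} (hN : 0 < N)
    (hM : ∀ i u, 0 < u → μ.real {ω | u ≤ |X i ω|} ≤ M / u) {i j : ℕ} (hij : i ≠ j) :
    μ.real {ω | N / 8 < |X i ω| ∧ N / 8 < |X j ω|} ≤ (8 * M / N) ^ 2 := by
  have hB : MeasurableSet {z : ℝ | N / 8 < |z|} :=
    measurableSet_lt measurable_const measurable_id.abs
  have h := (hindep.indepFun hij).measure_inter_preimage_eq_mul _ _ hB hB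
  have h1 : ∀ k, μ.real (X k ⁻¹' {z : ℝ | N / 8 < |z|}) ≤ 8 * M / N := fun k => by
    refine (measureReal_mono fun ω (hω : N / 8 < |X k ω|) => hω.le).trans
      ((hM k (N / 8) (by linarith)).trans ?_)
    rw [div_div_eq_mul_div, mul_comm]
  calc μ.real {ω | N / 8 < |X i ω| ∧ N / 8 < |X j ω|}
      = μ.real (X i ⁻¹' {z : ℝ | N / 8 < |z|} ∩ X j ⁻¹' {z : ℝ | N / 8 < |z|}) := rfl
    _ = μ.real (X i ⁻¹' {z : ℝ | N / 8 < |z|}) * μ.real (X j ⁻¹' {z : ℝ | N / 8 < |z|}) := by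
        simp only [measureReal_def, h, ENNReal.toReal_mul]
    _ ≤ (8 * M / N) * (8 * M / N) := mul_le_mul (h1 i) (h1 j) measureReal_nonneg
        (measureReal_nonneg.trans (h1 i))
    _ = _ := by ring

/-- Nonasymptotic single-big-jump estimate with an explicit constant that depends only on the tail
constant `M`. The summands are independent, with common tail bounds but possibly different laws. -/
lemma abs_measure_sum_sub_sum_measure_le {X : ℕ → Ω → ℝ} (hX : ∀ i, Measurable (X i))
    (hindep : iIndepFun X μ) {M N p : ℝ} (hp0 : 0 ≤ p) (hp1 : p ≤ 1) (hN : 8 ≤ N) {n : ℕ}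
    (hnN : n * ((1 + M) * Real.log N) ≤ N / 2) (hlog : 1 ≤ Real.log N)
    (hM : ∀ i u, 0 < u → μ.real {ω | u ≤ |X i ω|} ≤ M / u)
    (htail : ∀ i u, 0 < u → |μ.real {ω | u < X i ω} - p / u| ≤ M / u ^ 2) :
    |μ.real {ω | N < ∑ i ∈ Finset.range n, X i ω}
      - ∑ i ∈ Finset.range n, μ.real {ω | N < X i ω}|
      ≤ (Real.exp (64 * M) + 64 * M ^ 2
          + (1 + M) * (1 + (32 * M + 2) * (M / 4 + 1 / 2) + 5 * M))
        * (n ^ 2 * Real.log N ^ 2 / N ^ 2) := by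
  have hN0 : 0 < N := by linarith
  have hM0 : 0 ≤ M := by
    have := (abs_nonneg _).trans (htail 0 1 one_pos)
    simpa using this
  rcases Nat.eq_zero_or_pos n with rfl | hn
  · simp [hN0.not_gt]
  have hn1 : (1 : ℝ) ≤ n := by exact_mod_cast hn
  set m := (1 + M) * Real.log N with hm
  have hm1 : 1 ≤ m := by nlinarith
  have hmoment : ∀ i, ∫ ω, |cutoff (N / 8) (X i ω)| ∂μ ≤ m := fun i =>
    (integral_abs_cutoff_le (hX i) (by linarith) (hM i)).trans <| by
      have : Real.log (N / 8) ≤ Real.log N := Real.log_le_log (by linarith) (by linarith)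
      nlinarith
  have hsq : ∀ i, ∫ ω, cutoff (N / 8) (X i ω) ^ 2 ∂μ ≤ 2 * M * (N / 8) := fun i =>
    integral_cutoff_sq_le (hX i) (by linarith) (hM i)
  have hcard : ∀ i, (((Finset.range n).erase i).card : ℝ) ≤ n := fun i => by
    exact_mod_cast (Finset.card_erase_le.trans (Finset.card_range n).le)
  -- Each single-jump event costs `n * m / N ^ 2`.
  have hjump : ∀ i, |μ.real {ω | N - ∑ j ∈ (Finset.range n).erase i, cutoff (N / 8) (X j ω)
        < X i ω ∧ N / 8 < |X i ω|} - μ.real {ω | N < X i ω}|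
      ≤ (1 + (32 * M + 2) * (M / 4 + 1 / 2) + 5 * M) * (n * m / N ^ 2) := by
    intro i
    have h1 : |∫ ω, ∑ j ∈ (Finset.range n).erase i, cutoff (N / 8) (X j ω) ∂μ| ≤ n * m :=
      (abs_integral_sum_cutoff_le hX _ (by linarith) hmoment).trans
        (mul_le_mul_of_nonneg_right (hcard i) (by linarith))
    have h2 : ∫ ω, (∑ j ∈ (Finset.range n).erase i, cutoff (N / 8) (X j ω)) ^ 2 ∂μ
        ≤ n * (2 * M * (N / 8)) + (n * m) ^ 2 := by
      refine (integral_sq_sum_cutoff_le hX hindep _ (by linarith) hmoment hsq).trans ?_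
      have := hcard i
      gcongr
    refine (abs_measure_jump_sub_le (hX i)
      (Finset.measurable_sum _ fun j _ => (measurable_cutoff _).comp (hX j))
      (indepFun_sum_erase_cutoff hX hindep _ i _) hp0 hp1 hN0 (hM i) (htail i)
      (memLp_sum_cutoff hX _ (by linarith)) h1 h2).trans ?_
    have hnm : 1 ≤ n * m := one_le_mul_of_one_le_of_one_le hn1 hm1
    have h3 : n * (2 * M * (N / 8)) + (n * m) ^ 2 ≤ (M / 4 + 1 / 2) * (n * m) * N := by
      have e1 : (n * m) ^ 2 ≤ (n * m) * (N / 2) := by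
        rw [sq]; exact mul_le_mul_of_nonneg_left hnN (by linarith)
      have e2 : n * (M * N) ≤ n * m * (M * N) :=
        mul_le_mul_of_nonneg_right (by nlinarith) (by positivity)
      nlinarith
    calc n * m / N ^ 2 + (32 * M + 2) / N ^ 3 * (n * (2 * M * (N / 8)) + (n * m) ^ 2)
          + 5 * M / N ^ 2
        ≤ n * m / N ^ 2 + (32 * M + 2) / N ^ 3 * ((M / 4 + 1 / 2) * (n * m) * N)
          + 5 * M * (n * m) / N ^ 2 := by
          have e : 5 * M ≤ 5 * M * (n * m) := le_mul_of_one_le_right (by positivity) hnm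
          exact add_le_add (add_le_add le_rfl (mul_le_mul_of_nonneg_left h3 (by positivity)))
            (div_le_div_of_nonneg_right e (by positivity))
      _ = (1 + (32 * M + 2) * (M / 4 + 1 / 2) + 5 * M) * (n * m / N ^ 2) := by
          field_simp
  have hmain := abs_measure_sum_sub_sum_jump_le (μ := μ) hX (Finset.range n) N (N / 8)
  have hsmall := measure_sum_cutoff_ge_le hX hindep hM0 hN hn hnN hlog hM
  have hpairs : ∑ i ∈ Finset.range n, ∑ j ∈ (Finset.range n).erase i,
      μ.real {ω | N / 8 < |X i ω| ∧ N / 8 < |X j ω|} ≤ n * (n * (8 * M / N) ^ 2) := by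
    calc _ ≤ ∑ i ∈ Finset.range n, ∑ j ∈ (Finset.range n).erase i, (8 * M / N) ^ 2 :=
          Finset.sum_le_sum fun i _ => Finset.sum_le_sum fun j hj =>
            measure_two_jumps_le hindep hN0 hM (Finset.ne_of_mem_erase hj).symm
      _ ≤ ∑ i ∈ Finset.range n, n * (8 * M / N) ^ 2 := by
          refine Finset.sum_le_sum fun i _ => ?_
          rw [Finset.sum_const, nsmul_eq_mul]
          exact mul_le_mul_of_nonneg_right (hcard i) (sq_nonneg _)
      _ = _ := by simp
  have hdiff : |∑ i ∈ Finset.range n, μ.real {ω | N - ∑ j ∈ (Finset.range n).erase i,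
        cutoff (N / 8) (X j ω) < X i ω ∧ N / 8 < |X i ω|}
      - ∑ i ∈ Finset.range n, μ.real {ω | N < X i ω}|
      ≤ n * ((1 + (32 * M + 2) * (M / 4 + 1 / 2) + 5 * M) * (n * m / N ^ 2)) := by
    rw [← Finset.sum_sub_distrib]
    refine (Finset.abs_sum_le_sum_abs _ _).trans ?_
    calc _ ≤ ∑ i ∈ Finset.range n,
          (1 + (32 * M + 2) * (M / 4 + 1 / 2) + 5 * M) * (n * m / N ^ 2) :=
          Finset.sum_le_sum fun i _ => hjump i
      _ = _ := by simp
  have hlog2 : Real.log N ≤ Real.log N ^ 2 := by nlinarith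
  have hone : 1 ≤ Real.log N ^ 2 := by nlinarith
  have hbase : (n / N) ^ 2 ≤ n ^ 2 * Real.log N ^ 2 / N ^ 2 := by
    rw [div_pow]
    gcongr
    exact le_mul_of_one_le_right (by positivity) hone
  have hlin : n * (n * m / N ^ 2) ≤ (1 + M) * (n ^ 2 * Real.log N ^ 2 / N ^ 2) := by
    have : n * (n * m / N ^ 2) = (1 + M) * (n ^ 2 * Real.log N / N ^ 2) := by rw [hm]; ring
    rw [this]
    gcongr
  refine (abs_sub_le _ _ _).trans ((add_le_add hmain hdiff).trans ?_)
  have t1 := mul_le_mul_of_nonneg_left hbase (Real.exp_pos (64 * M)).le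
  have t2 := mul_le_mul_of_nonneg_left hbase (show 0 ≤ 64 * M ^ 2 by positivity)
  have t3 := mul_le_mul_of_nonneg_left hlin
    (show 0 ≤ 1 + (32 * M + 2) * (M / 4 + 1 / 2) + 5 * M by positivity)
  have t4 : n * (n * (8 * M / N) ^ 2) = 64 * M ^ 2 * (n / N) ^ 2 := by ring
  linarith

end Sum

/-! ### Asymptotics -/

/-- An asymptotic tail expansion holds on the whole half-line with a larger constant. -/
lemma exists_forall_abs_sub_le_of_isBigO {f : ℝ → ℝ} {p : ℝ} (hf0 : ∀ u, 0 ≤ f u)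
    (hf1 : ∀ u, f u ≤ 1) (hp0 : 0 ≤ p) (hp1 : p ≤ 1)
    (h : (fun u => f u - p / u) =O[atTop] fun u : ℝ => 1 / u ^ 2) :
    ∃ M, 0 ≤ M ∧ ∀ u, 0 < u → |f u - p / u| ≤ M / u ^ 2 := by
  obtain ⟨K, hK⟩ := h.bound
  obtain ⟨x₀, hx₀⟩ := eventually_atTop.1 hK
  set z := max x₀ 1
  have hz1 : 1 ≤ z := le_max_right _ _
  refine ⟨max K (z ^ 2 + z), le_max_of_le_right (by positivity), fun u hu => ?_⟩
  rcases le_total z u with hzu | huz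
  · have := hx₀ u ((le_max_left _ _).trans hzu)
    rw [Real.norm_eq_abs, Real.norm_of_nonneg (show 0 ≤ 1 / u ^ 2 by positivity),
      mul_one_div] at this
    refine this.trans ?_
    gcongr
    exact le_max_left _ _
  · have h1 : p / u ≤ 1 / u := by gcongr
    have h2 : 0 ≤ p / u := by positivity
    have h3 : 1 + 1 / u ≤ (z ^ 2 + z) / u ^ 2 := by
      rw [show 1 + 1 / u = (u ^ 2 + u) / u ^ 2 by field_simp]
      gcongr
    have h4 : (z ^ 2 + z) / u ^ 2 ≤ max K (z ^ 2 + z) / u ^ 2 := by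
      gcongr
      exact le_max_right _ _
    rw [abs_le]
    constructor <;> linarith [hf0 u, hf1 u]

section Asymptotic

variable {Ω : Type*} [MeasurableSpace Ω] {μ : Measure Ω} [IsProbabilityMeasure μ]

lemma measure_le_abs_le_of_tails {X : Ω → ℝ} {p q M₁ M₂ : ℝ} (hp1 : p ≤ 1) (hq1 : q ≤ 1)
    (hM₁ : 0 ≤ M₁) (hM₂ : 0 ≤ M₂)
    (hright : ∀ u, 0 < u → |μ.real {ω | u < X ω} - p / u| ≤ M₁ / u ^ 2)
    (hleft : ∀ u, 0 < u → |μ.real {ω | X ω < -u} - q / u| ≤ M₂ / u ^ 2) (u : ℝ) (hu : 0 < u) :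
    μ.real {ω | u ≤ |X ω|} ≤ (4 + 4 * M₁ + 4 * M₂) / u := by
  rw [le_div_iff₀ hu]
  rcases le_total u 1 with hu1 | hu1
  · have : μ.real {ω | u ≤ |X ω|} ≤ 1 := measureReal_le_one
    nlinarith [measureReal_nonneg (μ := μ) (s := {ω | u ≤ |X ω|})]
  · have hsub : {ω | u ≤ |X ω|} ⊆ {ω | u / 2 < X ω} ∪ {ω | X ω < -(u / 2)} := by
      intro ω hω
      have hω' : u ≤ |X ω| := hω
      rcases le_abs.1 hω' with h | h
      · exact Or.inl (show u / 2 < X ω by linarith)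
      · exact Or.inr (show X ω < -(u / 2) by linarith)
    have h1 := (abs_le.1 (hright (u / 2) (by linarith))).2
    have h2 := (abs_le.1 (hleft (u / 2) (by linarith))).2
    have h3 : ∀ r M : ℝ, r ≤ 1 → 0 ≤ M →
        (r / (u / 2) + M / (u / 2) ^ 2) * u ≤ 2 + 4 * M := by
      intro r M hr hM
      have e : (r / (u / 2) + M / (u / 2) ^ 2) * u = 2 * r + 4 * (M / u) := by field_simp; ring
      rw [e]
      linarith [div_le_self hM hu1]
    have h4 := (measureReal_mono hsub).trans (measureReal_union_le (μ := μ) _ _)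
    have h5 := h3 p M₁ hp1 hM₁
    have h6 := h3 q M₂ hq1 hM₂
    have h7 := mul_le_mul_of_nonneg_right (h4.trans (add_le_add
      (sub_le_iff_le_add'.1 h1) (sub_le_iff_le_add'.1 h2))) hu.le
    linarith

/-- Upper-tail asymptotics of the sum. The lower tail follows by applying this to `-X`. -/
lemma isBigO_measure_sum_sub {X : ℕ → Ω → ℝ} (hindep : iIndepFun X μ)
    (hident : ∀ i, IdentDistrib (X i) (X 0) μ μ) {p q : ℝ} (hp0 : 0 ≤ p) (hp1 : p ≤ 1)
    (hq0 : 0 ≤ q) (hq1 : q ≤ 1) (htail : HasTailExpansion μ (X 0) p q) {N : ℕ → ℝ}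
    (hN_top : Tendsto N atTop atTop)
    (hN_range : (fun n : ℕ => n * Real.log (N n) ^ 2) =o[atTop] N) :
    (fun n : ℕ => μ.real {ω | N n < ∑ i ∈ Finset.range n, X i ω}
      - n * μ.real {ω | N n < X 0 ω})
      =O[atTop] fun n : ℕ => (n : ℝ) ^ 2 * Real.log (N n) ^ 2 / N n ^ 2 := by
  obtain ⟨M₁, hM₁, hr⟩ := exists_forall_abs_sub_le_of_isBigO (fun _ => measureReal_nonneg)
    (fun _ => measureReal_le_one) hp0 hp1 htail.right
  obtain ⟨M₂, hM₂, hl⟩ := exists_forall_abs_sub_le_of_isBigO (fun _ => measureReal_nonneg)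
    (fun _ => measureReal_le_one) hq0 hq1 htail.left
  -- The variables are only almost everywhere measurable: pass to measurable versions.
  have hae : ∀ i, AEMeasurable (X i) μ := fun i => (hident i).aemeasurable_fst
  set Y : ℕ → Ω → ℝ := fun i => (hae i).mk (X i) with hY
  have hYm : ∀ i, Measurable (Y i) := fun i => (hae i).measurable_mk
  have hYX : ∀ i, X i =ᵐ[μ] Y i := fun i => (hae i).ae_eq_mk
  have hYindep : iIndepFun Y μ := hindep.congr hYX
  have hYident : ∀ i, IdentDistrib (Y i) (X 0) μ μ := fun i =>
    (IdentDistrib.of_ae_eq (hae i) (hYX i)).symm.trans (hident i)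
  have hYright : ∀ i u, μ.real {ω | u < Y i ω} = μ.real {ω | u < X 0 ω} := fun i u =>
    congrArg ENNReal.toReal ((hYident i).measure_mem_eq (s := Set.Ioi u) measurableSet_Ioi)
  have hYleft : ∀ i u, μ.real {ω | Y i ω < -u} = μ.real {ω | X 0 ω < -u} := fun i u =>
    congrArg ENNReal.toReal ((hYident i).measure_mem_eq (s := Set.Iio (-u)) measurableSet_Iio)
  have hsum : ∀ (n : ℕ) (r : ℝ), μ.real {ω | r < ∑ i ∈ Finset.range n, X i ω}
      = μ.real {ω | r < ∑ i ∈ Finset.range n, Y i ω} := fun n r => by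
    refine measureReal_congr ?_
    filter_upwards [ae_all_iff.2 hYX] with ω hω
    have : ∑ i ∈ Finset.range n, X i ω = ∑ i ∈ Finset.range n, Y i ω :=
      Finset.sum_congr rfl fun i _ => hω i
    exact congrArg (fun t => r < t) this
  set M := 4 + 4 * M₁ + 4 * M₂ with hM
  have hM0 : 0 ≤ M := by positivity
  have hYabs : ∀ i u, 0 < u → μ.real {ω | u ≤ |Y i ω|} ≤ M / u := fun i =>
    measure_le_abs_le_of_tails hp1 hq1 hM₁ hM₂ (fun u hu => by rw [hYright]; exact hr u hu)
      (fun u hu => by rw [hYleft]; exact hl u hu)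
  have hYtail : ∀ i u, 0 < u → |μ.real {ω | u < Y i ω} - p / u| ≤ M / u ^ 2 := by
    intro i u hu
    rw [hYright]
    refine (hr u hu).trans ?_
    gcongr
    linarith
  refine IsBigO.of_bound (Real.exp (64 * M) + 64 * M ^ 2
    + (1 + M) * (1 + (32 * M + 2) * (M / 4 + 1 / 2) + 5 * M)) ?_
  filter_upwards [hN_top.eventually_ge_atTop 8,
    hN_range.bound (show 0 < 1 / (2 * (1 + M)) by positivity)] with n hN8 hrange
  have hlog : 1 ≤ Real.log (N n) := by
    rw [Real.le_log_iff_exp_le (by linarith)]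
    linarith [Real.exp_one_lt_three]
  have hnN : n * ((1 + M) * Real.log (N n)) ≤ N n / 2 := by
    rw [Real.norm_eq_abs, Real.norm_eq_abs, abs_of_nonneg (by positivity),
      abs_of_nonneg (by linarith), one_div, inv_mul_eq_div, le_div_iff₀ (by positivity)] at hrange
    have : (n : ℝ) * (1 + M) * Real.log (N n) ≤ n * (1 + M) * Real.log (N n) ^ 2 :=
      mul_le_mul_of_nonneg_left (by nlinarith) (by positivity)
    linarith
  have h := abs_measure_sum_sub_sum_measure_le hYm hYindep hp0 hp1 hN8 hnN hlog hYabs hYtail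
  simp only [hYright, Finset.sum_const, Finset.card_range, nsmul_eq_mul] at h
  rw [hsum, Real.norm_eq_abs, Real.norm_eq_abs, abs_of_nonneg
    (show 0 ≤ (n : ℝ) ^ 2 * Real.log (N n) ^ 2 / N n ^ 2 by positivity)]
  exact h

end Asymptotic

theorem theorem1 {Ω : Type*} [MeasurableSpace Ω] (μ : Measure Ω) [IsProbabilityMeasure μ]
    (X : ℕ → Ω → ℝ)
    (hindep : iIndepFun X μ)
    (hident : ∀ i, IdentDistrib (X i) (X 0) μ μ)
    (p q : ℝ) (hp : 0 < p) (hq : 0 < q) (hpq : p + q = 1)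
    (htail : HasTailExpansion μ (X 0) p q)
    (c C₀ C : ℝ) (C' : ℂ)
    (hΨ : HasCharFunExpansion (charFun (μ.map (X 0))) c C₀ C C')
    (s : ℕ → ℝ) (hs : s ~[atTop] fun n : ℕ => (n : ℝ))
    (a : ℝ) (ha : 2 < a)
    (x N : ℕ → ℝ) (hN : ∀ n, N n = x n + centring μ (X 0) s n)
    (hN_top : Tendsto N atTop atTop)
    (hN_range : (fun n : ℕ => n * Real.log (N n) ^ 2) =o[atTop] N) :
    ((fun n : ℕ => μ.real {ω | N n < partialSum X n ω} - n * μ.real {ω | N n < X 0 ω})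
      =O[atTop] fun n : ℕ =>
        (n : ℝ) ^ 2 * Real.log (N n) ^ 2 / N n ^ 2 + n / N n ^ (2 - 2 / a)) ∧
    ((fun n : ℕ => μ.real {ω | partialSum X n ω < -N n} - n * μ.real {ω | X 0 ω < -N n})
      =O[atTop] fun n : ℕ =>
        (n : ℝ) ^ 2 * Real.log (N n) ^ 2 / N n ^ 2 + n / N n ^ (2 - 2 / a)) := by
  have hle : (fun n : ℕ => (n : ℝ) ^ 2 * Real.log (N n) ^ 2 / N n ^ 2) =O[atTop] fun n : ℕ =>
      (n : ℝ) ^ 2 * Real.log (N n) ^ 2 / N n ^ 2 + n / N n ^ (2 - 2 / a) := by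
    refine IsBigO.of_bound 1 ?_
    filter_upwards [hN_top.eventually_ge_atTop 0] with n hn
    have h1 : 0 ≤ (n : ℝ) ^ 2 * Real.log (N n) ^ 2 / N n ^ 2 := by positivity
    have h2 : 0 ≤ n / N n ^ (2 - 2 / a) := by positivity
    rw [Real.norm_of_nonneg h1, Real.norm_of_nonneg (add_nonneg h1 h2)]
    linarith
  have hp1 : p ≤ 1 := by linarith
  have hq1 : q ≤ 1 := by linarith
  refine ⟨(isBigO_measure_sum_sub hindep hident hp.le hp1 hq.le hq1 htail hN_top hN_range).trans
    hle, ?_⟩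
  have hneg : HasTailExpansion μ (fun ω => -X 0 ω) q p := by
    refine ⟨?_, ?_⟩
    · simpa only [lt_neg] using htail.left
    · simpa only [neg_lt_neg_iff] using htail.right
  have h := isBigO_measure_sum_sub (X := fun i ω => -X i ω)
    (hindep.comp (fun _ => Neg.neg) fun _ => measurable_neg)
    (fun i => (hident i).comp measurable_neg) hq.le hq1 hp.le hp1 hneg hN_top hN_range
  simp only [Finset.sum_neg_distrib, lt_neg] at h
  exact h.trans hle
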